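/- **Setting.** Let $\mathsf F$ be a polynomial functor on sets (built from identity, constants, $\times$, $+$), and write $\mathsf P$ for the power set, $\mathit{car}:\mathsf F\mathsf PA\to\mathsf P\mathsf FA$ for the map collecting all choices of elements, and $\mathit{cup}$ for the union of a set of sets. For $\phi:\mathsf P\mathsf FA\to\mathsf PA$ and $\psi:B\to\mathsf P\mathsf FB$, the recursive generator $r=rg(\phi,\psi):B\to\mathsf PA$ is the smallest solution of $r=\phi\circ \mathit{cup}\circ\mathsf P(\mathit{car}\circ\mathsf Fr)\circ\psi$. $T\,s$ is the set of states occurring in the elements of $\psi\,s$, and $S\,i$ is the set of all states in the search tree of $i$. If the search tree of $s$ has no infinite branch, $r\,s$ is the same for every solution $r$. A relational hylomorphism is $h=rg(\mathit{cup}\circ\mathsf P\phi,\psi)$ with $\phi:\mathsf FA\to\mathsf PA$. Programs $\phi=\lambda s.\,\mathrm{stmt}$ and $\psi=\lambda s.\,\mathrm{stmt}$ are statements built from skip, sequencing, if-then-else, "collect $e$" and "foreach $x\in e$"; expressions $e$ are built from variables, constants, and black-box total operators applied to expressions or $\lambda$-abstractions. The value of a statement is the finite set of the collected values. A program is a pair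 $(g,o)$ of a generator and an objective function $o:A\to\mathbb Z$; $(g,o)\sim_i(g',o')$ means that both generators terminate on $i$ and $\max_{p\in g\,i}o(p)=\max_{p\in g'\,i}o'(p)$, where one side is undefined (empty set of solutions) iff the other one is. A keyword preorder $R$ is given by finitely many comparisons $(op_j,k_j)$, $op_j\in\{\le,=\}$, $k_j:A\to\mathbb Z$, with $aRb\iff\bigwedge_j (k_j\,a)\;op_j\;(k_j\,b)$. $\mathit{thin}\,R\,X$ is the set of $R$-maximal elements of $X$, i.e. of those $a\in X$ such that $aRb$, $b\in X$ imply $bRa$. **The transformation system MetHyl** takes an input program $(h,o)$, $h$ the relational hylomorphism of $\phi,\psi$, and a set $I$ of instances (states), and produces a program $p^*$ in four steps, from solutions of the following synthesis tasks. *Step 1.* Find a keyword preorder $R$ with $(\le,o)\in R$ and no counterexample on any $i\in I$: for all $s\in S\,i$, $s_1,\dots,s_n\in T\,s$ and $p_j,p_j'\in h\,s_j$ with $p_jRp_j'$ for all $j$, if $(p_1,\dots,p_n)\twoheadrightarrow_s p$ then $(p'_1,\dots,p'_n)\twoheadrightarrow_s p'$ for some $p'$ with $pRp'$. Here $(p_1,\dots,p_n)\twoheadrightarrow_s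 p$ (for $p_j$ taken from $h\,s_j$) means that for some transition $t\in\psi\,s$ whose states are $s_1,\dots,s_n$ in this order, $p\in\phi(x)$, where $x$ is $t$ with each $s_j$ replaced by $p_j$. The new program is $(rg(\mathit{thin}\,R\circ \mathit{cup}\circ\mathsf P\phi,\psi),o)$. *Step 2 (may be skipped).* Partial solutions $p$ are replaced by $f_p\,p$, a tuple of scalars. In $\phi$, the smallest expressions with a tuple of scalars as value that properly enclose an occurrence of the input variable (queries $e$) are replaced by $q[e](s,t_1,\dots,t_m)$, and each collected expression (constructor $e$) is replaced by $c[e](s,t_1,\dots,t_m)$, where $s$ is the input variable and the $t_j$ are the temporary variables; $o$ and the keys $k$ of $R$ are replaced by $q[o]$, $q[k]$. The step requires that this rewriting leaves no condition and no foreach range that depends on $s$ outside a query, and that for every $i\in I$ and every input on which the query or constructor $e$ is invoked in the run of the program on $i$, the value of the query equals that of $q[e]$ (respectively the image under $f_p$ of the value of the constructor equals the value of $c[e]$) on the input with each partial solution replaced by its image under $f_p$. *Step 3.* Let $r$ be the resulting generator. Find a key function $f_m$ on states with $f_m\,s_1\ne f_m\,s_2$ whenever $i\in I$, $s_1,s_2\in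 S\,i$ and $r\,s_1\ne r\,s_2$, and replace $r$ by the memoized generator $r^{f_m}$: starting from an empty buffer, a call on $s$ returns the result stored for the key $f_m\,s$ if there is one, and otherwise executes the body of $r$ (with recursive calls in order of execution) and stores its result for this key. *Step 4 (may be skipped).* States $s$ are replaced by $f_s\,s$, a tuple of scalars, as in Step 2: $f_m$ and the queries in $\psi$ are replaced by synthesized functions, and so is each component of a collected element of $\mathsf FB$ (substates are constructors; decision values, including tags of sums, are queries). The requirements are those of Step 2, for the inputs that occur in the run of the memoized program on the instances $i\in I$. The new program runs on $f_s\,i$ for the instance $i$. **Theorem.** Let $(h,o)$ be an input program with $h$ a relational hylomorphism, and let $I$ be a set of instances such that for every $i\in I$ the search tree of $i$ has no infinite branch. Let $p^*$ be any program synthesized by MetHyl from $(h,o)$ and $I$, i.e. obtained by the four steps from any solutions of their synthesis tasks. Then $(h,o)\sim_i p^*$ for every $i\in I$. -/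

import Mathlib

namespace MetHyl

/-! ### Polynomial functors and types -/

/-- Polynomial functors: identity, constant functors, products and sums. -/
inductive PF : Type 1
  | I : PF
  | const (C : Type) : PF
  | prod (F G : PF) : PF
  | sum (F G : PF) : PF

/-- Action of a polynomial functor on objects. -/
def PF.obj : PF → Type → Type
  | .I, X => X
  | .const C, _ => C
  | .prod F G, X => F.obj X × G.obj X
  | .sum F G, X => F.obj X ⊕ G.obj X

/-- Action of a polynomial functor on arrows. -/
def PF.map : (F : PF) → {X Y : Type} → (X → Y) → F.obj X → F.obj Y
  | .I, _, _, f, x => f x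
  | .const _, _, _, _, x => x
  | .prod F G, _, _, f, x => (F.map f x.1, G.map f x.2)
  | .sum F _, _, _, f, .inl x => .inl (F.map f x)
  | .sum _ G, _, _, f, .inr x => .inr (G.map f x)

/-- `car[F] : F (P X) → P (F X)`. -/
def PF.car : (F : PF) → {X : Type} → F.obj (Set X) → Set (F.obj X)
  | .I, _, x => x
  | .const _, _, x => {x}
  | .prod F G, _, x => F.car x.1 ×ˢ G.car x.2
  | .sum F _, _, .inl x => Sum.inl '' F.car x
  | .sum _ G, _, .inr x => Sum.inr '' G.car x

/-- The sequence of all elements of `X` stored in an element of `F X`, from left to right. -/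
def PF.elems : (F : PF) → {X : Type} → F.obj X → List X
  | .I, _, x => [x]
  | .const _, _, _ => []
  | .prod F G, _, x => F.elems x.1 ++ G.elems x.2
  | .sum F _, _, .inl x => F.elems x
  | .sum _ G, _, .inr x => G.elems x

/-- `F.map` for an effectful function; effects are run from left to right. -/
def PF.mapM {M : Type → Type} [Monad M] :
    (F : PF) → {X Y : Type} → (X → M Y) → F.obj X → M (F.obj Y)
  | .I, _, _, f, x => f x
  | .const _, _, _, _, x => pure x
  | .prod F G, _, _, f, x => do
      let a ← F.mapM f x.1
      let b ← G.mapM f x.2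
      pure (a, b)
  | .sum F _, _, _, f, .inl x => do
      let a ← F.mapM f x
      pure (Sum.inl a)
  | .sum _ G, _, _, f, .inr x => do
      let a ← G.mapM f x
      pure (Sum.inr a)

/-- The types of the programming language. `data α` is an arbitrary (for instance recursive) data
type; `list τ` is the type of the finite collections over which `foreach` iterates. -/
inductive Ty : Type 1
  | unit : Ty
  | int : Ty
  | bool : Ty
  | data (α : Type) : Ty
  | list (τ : Ty) : Ty
  | prod (τ υ : Ty) : Ty
  | app (F : PF) (τ : Ty) : Ty

/-- The values of a type. -/
def Val : Ty → Type
  | .unit => Unit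
  | .int => ℤ
  | .bool => Bool
  | .data α => α
  | .list τ => List (Val τ)
  | .prod τ υ => Val τ × Val υ
  | .app F τ => F.obj (Val τ)

/-- The types whose values are tuples of scalar values. -/
def Ty.isScalar : Ty → Bool
  | .unit => true
  | .int => true
  | .bool => true
  | .prod τ υ => τ.isScalar && υ.isScalar
  | _ => false

/-- Values of the variables of a context. -/
def Env : List Ty → Type
  | [] => Unit
  | τ :: Γ => Val τ × Env Γ

def Env.append : {Δ Γ : List Ty} → Env Δ → Env Γ → Env (Δ ++ Γ)
  | [], _, _, env => env
  | _ :: _, _, xs, env => (xs.1, Env.append xs.2 env)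

/-- Variables of a context. -/
inductive Var : List Ty → Ty → Type 1
  | here {τ : Ty} {Γ : List Ty} : Var (τ :: Γ) τ
  | there {τ υ : Ty} {Γ : List Ty} (x : Var Γ τ) : Var (υ :: Γ) τ

def Var.get : {Γ : List Ty} → {τ : Ty} → Var Γ τ → Env Γ → Val τ
  | _, _, .here, env => env.1
  | _, _, .there x, env => x.get env.2

/-! ### The language: expressions and statements -/

/-- The meaning of a black-box operator with `n` operands. The `j`-th operand is a function of
parameters of types `(args j).1` (the empty list for an operand that is not a `λ`) into
`(args j).2`. The operator is a black box that can only call its operands (finitely often, adaptively)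
and finally returns a value. -/
inductive OpSem {n : ℕ} (args : Fin n → List Ty × Ty) (τ : Ty) : Type
  | ret (v : Val τ) : OpSem args τ
  | call (j : Fin n) (xs : Env (args j).1) (k : Val (args j).2 → OpSem args τ) : OpSem args τ

/-- The value returned by an operator on given operands. -/
def OpSem.run {n : ℕ} {args : Fin n → List Ty × Ty} {τ : Ty}
    (f : (j : Fin n) → Env (args j).1 → Val (args j).2) : OpSem args τ → Val τ
  | .ret v => v
  | .call j xs k => OpSem.run f (k (f j xs))

/-- Everything that is recorded (by `g`) in the calls which the operator makes to its operands. -/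
def OpSem.trace {n : ℕ} {args : Fin n → List Ty × Ty} {τ : Ty} {E : Type 1}
    (f : (j : Fin n) → Env (args j).1 → Val (args j).2)
    (g : (j : Fin n) → Env (args j).1 → Set E) : OpSem args τ → Set E
  | .ret _ => ∅
  | .call j xs k => g j xs ∪ OpSem.trace f g (k (f j xs))

/-- `Expr σ Γ τ`: expressions of type `τ` in the body of a program `λ s. …` with input variable `s`
of type `σ`, with temporary variables `Γ` (those bound by `foreach` and by inner `λ`s).
* `op args sem operands` is the application `⊕ E … E` of a black-box operator, where an operand may
  be of the form `λ x₁. … λ x_k. E`;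
* `call f` is the application `⊕ s t₁ … t_m` of a black-box operator to the input variable and the
  temporary variables in scope. -/
inductive Expr (σ : Ty) : List Ty → Ty → Type 1
  | input {Γ : List Ty} : Expr σ Γ σ
  | var {Γ : List Ty} {τ : Ty} (x : Var Γ τ) : Expr σ Γ τ
  | const {Γ : List Ty} {τ : Ty} (v : Val τ) : Expr σ Γ τ
  | op {Γ : List Ty} {τ : Ty} {n : ℕ} (args : Fin n → List Ty × Ty) (sem : OpSem args τ)
      (operands : (j : Fin n) → Expr σ ((args j).1 ++ Γ) (args j).2) : Expr σ Γ τ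
  | call {Γ : List Ty} {τ : Ty} (f : Val σ → Env Γ → Val τ) : Expr σ Γ τ

def Expr.eval {σ : Ty} (s : Val σ) : {Γ : List Ty} → {τ : Ty} → Expr σ Γ τ → Env Γ → Val τ
  | _, _, .input, _ => s
  | _, _, .var x, env => x.get env
  | _, _, .const v, _ => v
  | _, _, .op _ sem operands, env =>
      sem.run (fun j xs => (operands j).eval s (Env.append xs env))
  | _, _, .call f, env => f s env

/-- Statements with input variable of type `σ`, collecting values of type `ρ`. -/
inductive Stmt (σ ρ : Ty) : List Ty → Type 1
  | skip {Γ : List Ty} : Stmt σ ρ Γ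
  | seq {Γ : List Ty} (a b : Stmt σ ρ Γ) : Stmt σ ρ Γ
  | ite {Γ : List Ty} (e : Expr σ Γ .bool) (a b : Stmt σ ρ Γ) : Stmt σ ρ Γ
  | collect {Γ : List Ty} (e : Expr σ Γ ρ) : Stmt σ ρ Γ
  | foreach {Γ : List Ty} {τ : Ty} (e : Expr σ Γ (.list τ)) (a : Stmt σ ρ (τ :: Γ)) : Stmt σ ρ Γ

/-- The collected values, in the order of execution. -/
def Stmt.exec {σ ρ : Ty} (s : Val σ) : {Γ : List Ty} → Stmt σ ρ Γ → Env Γ → List (Val ρ)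
  | _, .skip, _ => []
  | _, .seq a b, env => a.exec s env ++ b.exec s env
  | _, .ite e a b, env => bif e.eval s env then a.exec s env else b.exec s env
  | _, .collect e, env => [e.eval s env]
  | _, .foreach e a, env => (e.eval s env : List _).flatMap (fun x => a.exec s (x, env))

/-! ### Queries and constructors: rewriting and instrumentation -/

/-- A synthesized function for each query: `?q[p] (s, t₁, …, t_m)`. -/
abbrev Queries (σ σ' : Ty) : Type 1 :=
  {Γ : List Ty} → {τ : Ty} → Expr σ Γ τ → Val σ' → Env Γ → Val τ

open Classical in
/-- Rewriting of expressions; `none` is the result `⊥`, and means that the expression is inside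
a query. A smallest scalar-valued expression around such a result is a query. -/
noncomputable def Expr.rewrite {σ σ' : Ty} (q : Queries σ σ') :
    {Γ : List Ty} → {τ : Ty} → Expr σ Γ τ → Option (Expr σ' Γ τ)
  | _, _, .input => none
  | _, _, .var x => some (.var x)
  | _, _, .const v => some (.const v)
  | _, τ, .op args sem operands =>
      if h : ∀ j, ((operands j).rewrite q).isSome then
        some (.op args sem (fun j => ((operands j).rewrite q).get (h j)))
      else if τ.isScalar then some (.call (q (.op args sem operands)))
      else none
  | _, τ, .call f => if τ.isScalar then some (.call (q (.call f))) else none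

/-- `e.Rewritable` says that the rewriting of `e` is not `⊥`. -/
def Expr.Rewritable {σ : Ty} : {Γ : List Ty} → {τ : Ty} → Expr σ Γ τ → Prop
  | _, _, .input => False
  | _, _, .var _ => True
  | _, _, .const _ => True
  | _, τ, .op _ _ operands => (∀ j, (operands j).Rewritable) ∨ τ.isScalar
  | _, τ, .call _ => τ.isScalar

/-- An invocation of the expression `expr` for given values of the temporary variables. -/
structure Event (σ : Ty) : Type 1 where
  {ctx : List Ty}
  {ty : Ty}
  expr : Expr σ ctx ty
  env : Env ctx

open Classical in
/-- The invocations of queries during the evaluation of an expression. -/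
noncomputable def Expr.queryTrace {σ : Ty} (s : Val σ) :
    {Γ : List Ty} → {τ : Ty} → Expr σ Γ τ → Env Γ → Set (Event σ)
  | _, _, .input, _ => ∅
  | _, _, .var _, _ => ∅
  | _, _, .const _, _ => ∅
  | _, τ, .op args sem operands, env =>
      if ∀ j, (operands j).Rewritable then
        sem.trace (fun j xs => (operands j).eval s (Env.append xs env))
          (fun j xs => (operands j).queryTrace s (Env.append xs env))
      else if τ.isScalar then {⟨.op args sem operands, env⟩}
      else ∅
  | _, τ, .call f, env => if τ.isScalar then {⟨.call f, env⟩} else ∅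

/-- The invocations of queries during the execution of a statement (outside its `collect`s). -/
noncomputable def Stmt.queryTrace {σ ρ : Ty} (s : Val σ) :
    {Γ : List Ty} → Stmt σ ρ Γ → Env Γ → Set (Event σ)
  | _, .skip, _ => ∅
  | _, .seq a b, env => a.queryTrace s env ∪ b.queryTrace s env
  | _, .ite e a b, env =>
      e.queryTrace s env ∪ bif e.eval s env then a.queryTrace s env else b.queryTrace s env
  | _, .collect _, _ => ∅
  | _, .foreach e a, env =>
      e.queryTrace s env ∪ {v | ∃ x ∈ (show List _ from e.eval s env), v ∈ a.queryTrace s (x, env)}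

/-- The executions of `collect e` during the execution of a statement: the values of the temporary
variables, for each context `Γ` and each `e`. -/
def Stmt.collectTrace {σ ρ : Ty} (s : Val σ) :
    {Γ : List Ty} → Stmt σ ρ Γ → Env Γ → Set (Event σ)
  | _, .skip, _ => ∅
  | _, .seq a b, env => a.collectTrace s env ∪ b.collectTrace s env
  | _, .ite e a b, env => bif e.eval s env then a.collectTrace s env else b.collectTrace s env
  | _, .collect e, env => {⟨e, env⟩}
  | _, .foreach e a, env => {v | ∃ x ∈ (show List _ from e.eval s env), v ∈ a.collectTrace s (x, env)}

/-- Rewriting of statements: expressions are rewritten with `q`, and the argument `e` of a `collect`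
is replaced by an operator `c e` applied to the input variable and the temporary variables. The
rewriting fails (`none`) if a condition or the range of a `foreach` is rewritten to `⊥`. -/
noncomputable def Stmt.rewrite {σ σ' ρ ρ' : Ty} (q : Queries σ σ')
    (c : {Γ : List Ty} → Expr σ Γ ρ → Val σ' → Env Γ → Val ρ') :
    {Γ : List Ty} → Stmt σ ρ Γ → Option (Stmt σ' ρ' Γ)
  | _, .skip => some .skip
  | _, .seq a b => do
      let a' ← a.rewrite q c
      let b' ← b.rewrite q c
      some (.seq a' b')
  | _, .ite e a b => do
      let e' ← e.rewrite q
      let a' ← a.rewrite q c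
      let b' ← b.rewrite q c
      some (.ite e' a' b')
  | _, .collect e => some (.collect (.call (c e)))
  | _, .foreach e a => do
      let e' ← e.rewrite q
      let a' ← a.rewrite q c
      some (.foreach e' a')

/-- Synthesized functions for the components of a value of type `F B`, where `E` is the type of
their common input: a constructor for each substate, a query for each decision value (including
the tags of sums). -/
def PF.Synth : PF → Type → Type → Type
  | .I, E, B' => E → B'
  | .const C, E, _ => E → C
  | .prod F G, E, B' => F.Synth E B' × G.Synth E B'
  | .sum F G, E, B' => (E → Bool) × F.Synth E B' × G.Synth E B'

/-- The value of type `F B'` with the components computed by the synthesized functions; the tag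
`true` selects the left summand. -/
def PF.build : (F : PF) → {E B' : Type} → F.Synth E B' → E → F.obj B'
  | .I, _, _, y, e => y e
  | .const _, _, _, y, e => y e
  | .prod F G, _, _, y, e => (F.build y.1 e, G.build y.2 e)
  | .sum F G, _, _, y, e =>
      match y.1 e with
      | true => .inl (F.build y.2.1 e)
      | false => .inr (G.build y.2.2 e)

/-- The synthesized functions on input `e` are correct for the components of `v`: they return the
image under `f` of each substate, and each decision value itself. -/
def PF.SynthCorrect : (F : PF) → {E B B' : Type} → (B → B') → F.Synth E B' → E → F.obj B → Prop
  | .I, _, _, _, f, y, e, v => f v = y e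
  | .const _, _, _, _, _, y, e, v => v = y e
  | .prod F G, _, _, _, f, y, e, v => F.SynthCorrect f y.1 e v.1 ∧ G.SynthCorrect f y.2 e v.2
  | .sum F _, _, _, _, f, y, e, .inl v => y.1 e = true ∧ F.SynthCorrect f y.2.1 e v
  | .sum _ G, _, _, _, f, y, e, .inr v => y.1 e = false ∧ G.SynthCorrect f y.2.2 e v

/-! ### Recursive generators, thinning, memoization -/

section Generators

variable {F : PF} {A B : Type}

/-- `Child ψ s' s`: the state `s'` occurs in a transition of `s`, that is, `s' ∈ T s`. -/
def Child (ψ : B → Set (F.obj B)) (s' s : B) : Prop := ∃ t ∈ ψ s, s' ∈ F.elems t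

/-- `S i`: all states in the search tree of `i`. -/
def States (ψ : B → Set (F.obj B)) (i : B) : Set B :=
  {s | Relation.ReflTransGen (fun a b => Child ψ b a) i s}

/-- The search tree of `i` has no infinite branch. -/
abbrev Terminates (ψ : B → Set (F.obj B)) (i : B) : Prop := Acc (Child ψ) i

/-- `cup ∘ P (car[F] ∘ F r) ∘ ψ`. -/
def expand (ψ : B → Set (F.obj B)) (r : B → Set A) (s : B) : Set (F.obj A) :=
  ⋃ t ∈ ψ s, F.car (F.map r t)

open Classical in
/-- The recursive generator `rg(φ, ψ)`, the solution of `r = φ ∘ cup ∘ P (car[F] ∘ F r) ∘ ψ`, on the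
states with a terminating search tree, where the solution is unique (see `rg_eq`, `rg_unique`).
Its value on other states is a dummy. -/
noncomputable def rg (φ : Set (F.obj A) → Set A) (ψ : B → Set (F.obj B)) (s : B) : Set A :=
  if h : Terminates ψ s then
    Acc.rec (motive := fun _ _ => Set A)
      (fun s _ ih => φ (expand ψ (fun s' => if hs : Child ψ s' s then ih s' hs else ∅) s)) h
  else ∅

theorem PF.map_congr : (F : PF) → {X Y : Type} → (f g : X → Y) → (x : F.obj X) →
    (∀ a ∈ F.elems x, f a = g a) → F.map f x = F.map g x
  | .I, _, _, _, _, x, h => h x (List.mem_singleton.2 rfl)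
  | .const _, _, _, _, _, _, _ => rfl
  | .prod F G, _, _, f, g, x, h => by
      simp only [PF.elems, List.mem_append] at h
      simp only [PF.map]
      rw [F.map_congr f g x.1 (fun a ha => h a (.inl ha)),
        G.map_congr f g x.2 (fun a ha => h a (.inr ha))]
  | .sum F _, _, _, f, g, .inl x, h => by
      simp only [PF.map]
      rw [F.map_congr f g x h]
  | .sum _ G, _, _, f, g, .inr x, h => by
      simp only [PF.map]
      rw [G.map_congr f g x h]

theorem expand_congr (ψ : B → Set (F.obj B)) (r r' : B → Set A) (s : B)
    (h : ∀ s', Child ψ s' s → r s' = r' s') : expand ψ r s = expand ψ r' s := by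
  unfold expand
  refine Set.iUnion₂_congr fun t ht => ?_
  rw [F.map_congr r r' t (fun a ha => h a ⟨t, ht, ha⟩)]

/-- `rg φ ψ` solves its defining equation at terminating states. -/
theorem rg_eq (φ : Set (F.obj A) → Set A) (ψ : B → Set (F.obj B)) (s : B)
    (h : Terminates ψ s) : rg φ ψ s = φ (expand ψ (rg φ ψ) s) := by
  cases h with
  | intro s hs =>
    rw [rg, dif_pos (Acc.intro s hs)]
    change φ _ = φ _
    congr 1
    apply expand_congr
    intro s' hs'
    rw [dif_pos hs', rg, dif_pos (hs s' hs')]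

/-- Every solution of the equation (in particular the smallest one) agrees with `rg φ ψ` at
terminating states. -/
theorem rg_unique (φ : Set (F.obj A) → Set A) (ψ : B → Set (F.obj B)) (r : B → Set A)
    (hr : ∀ s, r s = φ (expand ψ r s)) (s : B) (h : Terminates ψ s) : r s = rg φ ψ s := by
  induction h with
  | intro s hs ih =>
    rw [hr s, rg_eq φ ψ s (Acc.intro s hs)]
    congr 1
    exact expand_congr ψ _ _ s ih

/-- `cup ∘ P φ`. -/
def lift (φ : F.obj A → Set A) (X : Set (F.obj A)) : Set A := ⋃ x ∈ X, φ x

/-- The relational hylomorphism of `φ` and `ψ`. -/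
noncomputable def hylo (φ : F.obj A → Set A) (ψ : B → Set (F.obj B)) : B → Set A :=
  rg (lift φ) ψ

/-- Thinning with respect to a preorder: the maximal elements of `s`, that is, the elements that are
not strictly dominated by an element of `s`. -/
def thin (R : A → A → Prop) (s : Set A) : Set A := {a | a ∈ s ∧ ∀ b ∈ s, R a b → R b a}

/-- For a finite set `s`, `thin R s` is the smallest subset of `s`, among those that do not separate
`R`-equivalent elements of `s`, in which every element of `s` is dominated. (If `R` is antisymmetric
on `s`, this is the smallest among all such subsets.) -/
theorem thin_isLeast (R : A → A → Prop) (hrefl : ∀ a, R a a)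
    (htrans : ∀ a b c, R a b → R b c → R a c) (s : Set A) (hs : s.Finite) :
    IsLeast {t : Set A | t ⊆ s ∧ (∀ a ∈ s, ∃ b ∈ t, R a b) ∧
      ∀ a ∈ s, ∀ b ∈ t, R a b → R b a → a ∈ t} (thin R s) := by
  refine ⟨⟨fun a ha => ha.1, fun a ha => ?_, fun a ha b hb hab hba => ⟨ha, fun c hc hac =>
    htrans _ _ _ (hb.2 c hc (htrans _ _ _ hba hac)) hba⟩⟩, fun t ht a ha => ?_⟩
  · let _ : Preorder A := { le := R, le_refl := hrefl, le_trans := htrans }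
    obtain ⟨b, hab, hb⟩ := hs.exists_le_maximal ha
    exact ⟨b, ⟨hb.1, fun c hc hbc => hb.2 hc hbc⟩, hab⟩
  · obtain ⟨b, hb, hab⟩ := ht.2.1 a ha.1
    exact ht.2.2 a ha.1 b hb hab (ha.2 b (ht.1 hb) hab)

/-- The state of a memoized run: the stored results, and (as instrumentation) the states on which
the generator has been called and those for which the result has been computed. -/
structure MemoState (A B K : Type) where
  buffer : K → Option (Set A)
  called : Set B
  expanded : Set B

def MemoState.init {A B K : Type} : MemoState A B K := ⟨fun _ => none, ∅, ∅⟩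

open Classical in
/-- The memoized generator `rg(φ, ψ)^key`, as a program that looks the key of the state up in
the buffer, and computes and stores the result if there is none. The first argument bounds the
recursion depth; the program fails if it is exceeded. -/
noncomputable def memoRun {K : Type} (φ : Set (F.obj A) → Set A) (ψ : B → List (F.obj B))
    (key : B → K) : ℕ → B → StateT (MemoState A B K) Option (Set A)
  | 0, _ => fun _ => none
  | n + 1, s => do
      modify (fun st => { st with called := insert s st.called })
      match (← get).buffer (key s) with
      | some v => pure v
      | none => do
          modify (fun st => { st with expanded := insert s st.expanded })
          let xs ← (ψ s).mapM (fun t => F.mapM (memoRun φ ψ key n) t)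
          let v := φ {y | ∃ x ∈ xs, y ∈ F.car x}
          modify (fun st => { st with buffer := Function.update st.buffer (key s) (some v) })
          pure v

/-- The memoized generator, started with an empty buffer, terminates on `i` with result `v` and
final state `st`. -/
def MemoReturns {K : Type} (φ : Set (F.obj A) → Set A) (ψ : B → List (F.obj B))
    (key : B → K) (i : B) (v : Set A) (st : MemoState A B K) : Prop :=
  ∃ n, (memoRun φ ψ key n i).run MemoState.init = some (v, st)

end Generators

/-! ### Keyword preorders -/

inductive CmpOp
  | le
  | eq

def CmpOp.Holds : CmpOp → ℤ → ℤ → Prop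
  | .le, a, b => a ≤ b
  | .eq, a, b => a = b

/-- The comparisons `(op, k)` of a keyword preorder. -/
abbrev Keywords (α : Type) : Type := List (CmpOp × (α → ℤ))

/-- The keyword preorder itself. -/
def Keywords.Rel {α : Type} (R : Keywords α) (a b : α) : Prop :=
  ∀ c ∈ R, c.1.Holds (c.2 a) (c.2 b)

/-! ### Programs and equivalence -/

/-- A program: a generator (`Returns i v`: on instance `i` the generator terminates with the set `v`
of solutions) and an objective function. -/
structure Program (Inst : Type) where
  Sol : Type
  Returns : Inst → Set Sol → Prop
  objective : Sol → ℤ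

/-- Equivalence on an instance: both generators terminate, and the largest objective values agree
(on finite sets this includes that one set is empty if and only if the other one is). -/
def Program.Equiv {Inst : Type} (i : Inst) (P Q : Program Inst) : Prop :=
  ∃ v w, P.Returns i v ∧ Q.Returns i w ∧
    ∀ m : ℤ, IsGreatest (P.objective '' v) m ↔ IsGreatest (Q.objective '' w) m

/-- The function `λ s. stmt` into sets. -/
def Stmt.denote {σ ρ : Ty} (a : Stmt σ ρ []) (s : Val σ) : Set (Val ρ) := {v | v ∈ a.exec s ()}

/-- An input program `(hylo φ ψ, o)`, with states of type `B` and partial solutions of type `A`. -/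
structure HyloProgram : Type 1 where
  F : PF
  A : Ty
  B : Ty
  phi : Stmt (.app F A) A []
  psi : Stmt B (.app F B) []
  obj : Expr A [] .int

namespace HyloProgram

variable (P : HyloProgram)

/-- `φ` as a function. -/
def φ : P.F.obj (Val P.A) → Set (Val P.A) := P.phi.denote

/-- `ψ` as a function. -/
def ψ : Val P.B → Set (P.F.obj (Val P.B)) := P.psi.denote

/-- `o` as a function. -/
def o (p : Val P.A) : ℤ := P.obj.eval p ()

/-- The hylomorphism `h`. -/
noncomputable def h : Val P.B → Set (Val P.A) := hylo P.φ P.ψ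

def toProgram : Program (Val P.B) where
  Sol := Val P.A
  Returns := fun i v => Terminates P.ψ i ∧ v = P.h i
  objective := P.o

/-- `(p₁, …, p_n) ↠_s p`, where the `p_j` are taken from the results for the states `s_j`: in `h s`
there is an invocation of `φ`, made for a transition with substates `s₁, …, s_n`, in whose input
these are replaced by `p₁, …, p_n`, and in whose output `p` occurs. -/
def Constructs (s : Val P.B) (ss : List (Val P.B)) (ps : List (Val P.A)) (p : Val P.A) : Prop :=
  ∃ t ∈ P.ψ s, P.F.elems t = ss ∧
    ∃ x ∈ P.F.car (P.F.map P.h t), P.F.elems x = ps ∧ p ∈ P.φ x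

/-- Counterexamples `CE(R, i)`: the sequences of pairs of partial solutions, componentwise related by
`R`, for which the dominance between the newly constructed solutions fails. -/
def CE (R : Keywords (Val P.A)) (i : Val P.B) : Set (List (Val P.A × Val P.A)) :=
  {e | ∃ s ∈ States P.ψ i, ∃ ss : List (Val P.B), (∀ s' ∈ ss, Child P.ψ s' s) ∧
    List.Forall₂ (fun s' pp => pp.1 ∈ P.h s' ∧ pp.2 ∈ P.h s') ss e ∧
    (∀ pp ∈ e, R.Rel pp.1 pp.2) ∧
    ∃ p₁, P.Constructs s ss (e.map Prod.fst) p₁ ∧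
      ∀ p₂, P.Constructs s ss (e.map Prod.snd) p₂ → ¬ R.Rel p₁ p₂}

/-- Correctness requirement of Step 1 for the keyword preorder `R`. -/
def Step1 (I : Set (Val P.B)) (R : Keywords (Val P.A)) : Prop :=
  (CmpOp.le, P.o) ∈ R ∧ ∀ i ∈ I, P.CE R i = ∅

end HyloProgram

/-- Programs `(rg(thin R ∘ cup ∘ P φ, ψ), o)`, with states of type `B`. -/
structure ThinProgram (F : PF) (B : Ty) : Type 1 where
  A : Ty
  phi : Stmt (.app F A) A []
  psi : Stmt B (.app F B) []
  R : Keywords (Val A)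
  o : Val A → ℤ

/-- The program constructed by Step 1. -/
def HyloProgram.thinned (P : HyloProgram) (R : Keywords (Val P.A)) : ThinProgram P.F P.B where
  A := P.A
  phi := P.phi
  psi := P.psi
  R := R
  o := P.o

namespace ThinProgram

variable {F : PF} {B : Ty} (P : ThinProgram F B)

def φ : F.obj (Val P.A) → Set (Val P.A) := P.phi.denote

def ψ : Val B → Set (F.obj (Val B)) := P.psi.denote

/-- `ψ`, with its results in the order of execution. -/
def ψList (s : Val B) : List (F.obj (Val B)) := P.psi.exec s ()

/-- `thin R ∘ cup ∘ P φ`. -/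
def thinLift (X : Set (F.obj (Val P.A))) : Set (Val P.A) := thin P.R.Rel (lift P.φ X)

/-- The generator. -/
noncomputable def r : Val B → Set (Val P.A) := rg P.thinLift P.ψ

/-- The inputs on which `φ` is invoked when the program is run on `i`. -/
def phiInputs (i : Val B) : Set (F.obj (Val P.A)) :=
  {x | ∃ s ∈ States P.ψ i, x ∈ expand P.ψ P.r s}

/-- `RE(k, i)` for a key function or the objective function `k`: keys are evaluated by `thin` on all
its arguments, the objective function on the final solutions. -/
def keyExamples (i : Val B) (k : Val P.A → ℤ) : Set (Val P.A) :=
  {p | ((∃ op, (op, k) ∈ P.R) ∧ ∃ s ∈ States P.ψ i, p ∈ lift P.φ (expand P.ψ P.r s)) ∨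
    (k = P.o ∧ p ∈ P.r i)}

/-- `RE(e, i)` for a query `e` extracted from `φ`. -/
def queryExamples (i : Val B) {Γ : List Ty} {τ : Ty} (e : Expr (.app F P.A) Γ τ) :
    Set (Val (.app F P.A) × Env Γ) :=
  {x | x.1 ∈ P.phiInputs i ∧ ⟨e, x.2⟩ ∈ P.phi.queryTrace x.1 ()}

/-- `RE(e, i)` for a constructor `e` extracted from `φ`. -/
def constructorExamples (i : Val B) {Γ : List Ty} (e : Expr (.app F P.A) Γ P.A) :
    Set (Val (.app F P.A) × Env Γ) :=
  {x | x.1 ∈ P.phiInputs i ∧ ⟨e, x.2⟩ ∈ P.phi.collectTrace x.1 ()}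

end ThinProgram

/-- A solution of the synthesis task of Step 2 (change of the representation of partial solutions)
for the program `P` and the instances `I`: the function `?f_p`, the functions `?q` (for keys and
for queries extracted from `φ`) and the functions `?c`. -/
structure Step2Solution {F : PF} {B : Ty} (P : ThinProgram F B) (I : Set (Val B)) : Type 1 where
  A' : Ty
  scalar : A'.isScalar
  f : Val P.A → Val A'
  qKey : (Val P.A → ℤ) → Val A' → ℤ
  q : Queries (.app F P.A) (.app F A')
  c : {Γ : List Ty} → Expr (.app F P.A) Γ P.A → F.obj (Val A') → Env Γ → Val A'
  key_correct : ∀ i ∈ I, ∀ k, ∀ p ∈ P.keyExamples i k, k p = qKey k (f p)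
  query_correct : ∀ i ∈ I, ∀ {Γ : List Ty} {τ : Ty} (e : Expr (.app F P.A) Γ τ),
    ∀ x ∈ P.queryExamples i e, e.eval x.1 x.2 = q e (F.map f x.1) x.2
  constructor_correct : ∀ i ∈ I, ∀ {Γ : List Ty} (e : Expr (.app F P.A) Γ P.A),
    ∀ x ∈ P.constructorExamples i e, f (e.eval x.1 x.2) = c e (F.map f x.1) x.2

/-- Step 2 transforms `P` into `P'`. The step may be skipped. -/
inductive Step2 {F : PF} {B : Ty} (I : Set (Val B)) :
    ThinProgram F B → ThinProgram F B → Prop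
  | skip (P : ThinProgram F B) : Step2 I P P
  | incrementalize (P : ThinProgram F B) (S : Step2Solution P I)
      (phi' : Stmt (.app F S.A') S.A' []) (hphi : P.phi.rewrite S.q S.c = some phi') :
      Step2 I P
        { A := S.A'
          phi := phi'
          psi := P.psi
          R := P.R.map (fun c => (c.1, S.qKey c.2))
          o := S.qKey P.o }

/-- Correctness requirement of Step 3 for the key function `?f_m`: different keys for any two states
in the search tree of an instance for which the results of the generator are different. -/
def Step3 {F : PF} {B : Ty} (P : ThinProgram F B) (I : Set (Val B)) {K : Type}
    (fm : Val B → K) : Prop :=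
  ∀ i ∈ I, ∀ s₁ ∈ States P.ψ i, ∀ s₂ ∈ States P.ψ i, P.r s₁ ≠ P.r s₂ → fm s₁ ≠ fm s₂

/-- Programs `(rg(thin R ∘ cup ∘ P φ, ψ)^key, o)`, which start on the state `init i` for the
instance `i`. -/
structure MemoProgram (Inst : Type) : Type 1 where
  F : PF
  B : Ty
  base : ThinProgram F B
  K : Type
  key : Val B → K
  init : Inst → Val B

namespace MemoProgram

variable {Inst : Type} (P : MemoProgram Inst)

/-- The memoized generator terminates on `i` with result `v` and final state `st`. -/
def Run (i : Inst) (v : Set (Val P.base.A)) (st : MemoState (Val P.base.A) (Val P.B) P.K) :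
    Prop :=
  MemoReturns P.base.thinLift P.base.ψList P.key (P.init i) v st

def toProgram : Program Inst where
  Sol := Val P.base.A
  Returns := fun i v => ∃ st, P.Run i v st
  objective := P.base.o

/-- `RE(key, i)`: the states whose key is computed in the run on `i`. -/
def keyExamples (i : Inst) : Set (Val P.B) := {s | ∃ v st, P.Run i v st ∧ s ∈ st.called}

/-- The states on which `ψ` is invoked in the run on `i`. -/
def psiInputs (i : Inst) : Set (Val P.B) := {s | ∃ v st, P.Run i v st ∧ s ∈ st.expanded}

/-- `RE(e, i)` for a query `e` extracted from `ψ`. -/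
def queryExamples (i : Inst) {Γ : List Ty} {τ : Ty} (e : Expr P.B Γ τ) :
    Set (Val P.B × Env Γ) :=
  {x | x.1 ∈ P.psiInputs i ∧ ⟨e, x.2⟩ ∈ P.base.psi.queryTrace x.1 ()}

/-- The inputs on which the argument `e` of a `collect` in `ψ` is evaluated in the run on `i`. -/
def collectExamples (i : Inst) {Γ : List Ty} (e : Expr P.B Γ (.app P.F P.B)) :
    Set (Val P.B × Env Γ) :=
  {x | x.1 ∈ P.psiInputs i ∧ ⟨e, x.2⟩ ∈ P.base.psi.collectTrace x.1 ()}

end MemoProgram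

/-- The program `(rg(thin R ∘ cup ∘ P φ, ψ)^fm, o)` constructed by Step 3. -/
def ThinProgram.memoized {F : PF} {B : Ty} (P : ThinProgram F B) {K : Type} (fm : Val B → K) :
    MemoProgram (Val B) where
  F := F
  B := B
  base := P
  K := K
  key := fm
  init := id

/-- A solution of the synthesis task of Step 4 (change of the representation of states) for
the program `P` and the instances `I`: the function `?f_s`, the queries for the key function and
those extracted from `ψ`, and, for each `collect e` in `ψ`, the constructors and queries for the
components of `e`. -/
structure Step4Solution {Inst : Type} (P : MemoProgram Inst) (I : Set Inst) : Type 1 where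
  B' : Ty
  scalar : B'.isScalar
  f : Val P.B → Val B'
  qKey : Val B' → P.K
  q : Queries P.B B'
  c : {Γ : List Ty} → Expr P.B Γ (.app P.F P.B) → P.F.Synth (Val B' × Env Γ) (Val B')
  key_correct : ∀ i ∈ I, ∀ s ∈ P.keyExamples i, P.key s = qKey (f s)
  query_correct : ∀ i ∈ I, ∀ {Γ : List Ty} {τ : Ty} (e : Expr P.B Γ τ),
    ∀ x ∈ P.queryExamples i e, e.eval x.1 x.2 = q e (f x.1) x.2
  component_correct : ∀ i ∈ I, ∀ {Γ : List Ty} (e : Expr P.B Γ (.app P.F P.B)),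
    ∀ x ∈ P.collectExamples i e, P.F.SynthCorrect f (c e) (f x.1, x.2) (e.eval x.1 x.2)

/-- The operators `?c e` which replace the arguments `e` of the `collect`s in `ψ`. -/
def Step4Solution.collect {Inst : Type} {P : MemoProgram Inst} {I : Set Inst}
    (S : Step4Solution P I) {Γ : List Ty} (e : Expr P.B Γ (.app P.F P.B)) (s : Val S.B')
    (env : Env Γ) : Val (.app P.F S.B') :=
  P.F.build (S.c e) (s, env)

/-- Step 4 transforms `P` into `P'`. The step may be skipped. -/
inductive Step4 {Inst : Type} (I : Set Inst) : MemoProgram Inst → MemoProgram Inst → Prop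
  | skip (P : MemoProgram Inst) : Step4 I P P
  | incrementalize (P : MemoProgram Inst) (S : Step4Solution P I)
      (psi' : Stmt S.B' (.app P.F S.B') [])
      (hpsi : P.base.psi.rewrite S.q (S.collect) = some psi') :
      Step4 I P
        { F := P.F
          B := S.B'
          base :=
            { A := P.base.A
              phi := P.base.phi
              psi := psi'
              R := P.base.R
              o := P.base.o }
          K := P.K
          key := S.qKey
          init := fun i => S.f (P.init i) }

/-- `Synthesizes P I p`: the program `p` is a result of the transformation system on the input program
`P` and the instances `I`, with any solutions of the synthesis tasks of the four steps. -/
inductive Synthesizes (P : HyloProgram) (I : Set (Val P.B)) : MemoProgram (Val P.B) → Prop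
  | intro (R : Keywords (Val P.A)) (h₁ : P.Step1 I R)
      (P₂ : ThinProgram P.F P.B) (h₂ : Step2 I (P.thinned R) P₂)
      (K : Type) (fm : Val P.B → K) (h₃ : Step3 P₂ I fm)
      (p : MemoProgram (Val P.B)) (h₄ : Step4 I (P₂.memoized fm) p) :
      Synthesizes P I p

end MetHyl

/-!
Each of the four steps preserves the largest objective value, for a reason of its own.

* Thinning. By induction on the search tree, every solution of the hylomorphism is dominated by one
  that survives thinning (`HyloProgram.thinned_dominates`): the arguments of `φ` are replaced by
  dominating ones that survived in the substates, the absence of counterexamples gives a dominating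
  result, and in a finite set every element lies below a maximal one. As `(≤, o)` is one of the
  comparisons, the best objective value survives.
* Representation of partial solutions. If all invocations of queries and constructors are
  answered correctly, a rewritten statement runs through the same branches and iterations as the
  original one and collects the images of its values (`Stmt.exec_rewrite`). As the keys are
  preserved too, the new generator returns the image of the old result in every state of the search
  tree (`Step2Solution.r_program`).
* Memoization. The invariant is that a result stored for a key is the right one for every state of
  the search tree with this key. It holds for the empty buffer, is kept by every call, and makes
  every call return the result of the recursive generator (`memoRun_yields`). The search tree is
  finitely branching and has no infinite branch, so that some recursion depth suffices.
* Representation of states. The run on the new representation proceeds in lockstep with the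
  memoized run and has the same buffer throughout (`memoRun_simulatedBy`). The synthesized functions
  need to be correct only on the states that this one run calls or expands.
-/

namespace MetHyl

/-! ### Polynomial functors: membership in `car` and change of the elements -/

/-- The elements of a member of `car (F h t)` are choices from the sets assigned to the elements
of `t`. -/
theorem PF.forall₂_elems_of_mem_car : (F : PF) → {X Y : Type} → (h : X → Set Y) →
    (t : F.obj X) → (x : F.obj Y) → x ∈ F.car (F.map h t) →
    List.Forall₂ (fun s p => p ∈ h s) (F.elems t) (F.elems x)
  | .I, _, _, _, _, _, hx => .cons hx .nil
  | .const _, _, _, _, _, _, _ => .nil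
  | .prod F G, _, _, h, t, x, hx =>
      List.rel_append (F.forall₂_elems_of_mem_car h t.1 x.1 hx.1)
        (G.forall₂_elems_of_mem_car h t.2 x.2 hx.2)
  | .sum F _, _, _, h, .inl t, _, hx => by
      obtain ⟨y, hy, rfl⟩ := hx
      exact F.forall₂_elems_of_mem_car h t y hy
  | .sum _ G, _, _, h, .inr t, _, hx => by
      obtain ⟨y, hy, rfl⟩ := hx
      exact G.forall₂_elems_of_mem_car h t y hy

theorem PF.length_elems_of_mem_car (F : PF) {X Y : Type} {h : X → Set Y} {t : F.obj X}
    {x : F.obj Y} (hx : x ∈ F.car (F.map h t)) : (F.elems t).length = (F.elems x).length :=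
  (F.forall₂_elems_of_mem_car h t x hx).length_eq

/-- Membership in `car (F h t)` depends on `h` only through the elements, once the shape of `x`
is known to be that of `t`. -/
theorem PF.mem_car_of_forall₂ : (F : PF) → {X Y : Type} → (h r : X → Set Y) →
    (t : F.obj X) → (x : F.obj Y) → x ∈ F.car (F.map h t) →
    List.Forall₂ (fun s p => p ∈ r s) (F.elems t) (F.elems x) → x ∈ F.car (F.map r t)
  | .I, _, _, _, _, _, _, _, hr => by
      cases hr with
      | cons h _ => exact h
  | .const _, _, _, _, _, _, _, hx, _ => hx
  | .prod F G, _, _, h, r, t, x, hx, hr => by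
      have hlen := F.length_elems_of_mem_car hx.1
      have h₁ := List.forall₂_take (F.elems t.1).length hr
      have h₂ := List.forall₂_drop (F.elems t.1).length hr
      simp only [PF.elems] at h₁ h₂
      rw [List.take_left, hlen, List.take_left] at h₁
      rw [List.drop_left, hlen, List.drop_left] at h₂
      exact ⟨F.mem_car_of_forall₂ h r t.1 x.1 hx.1 h₁, G.mem_car_of_forall₂ h r t.2 x.2 hx.2 h₂⟩
  | .sum F _, _, _, h, r, .inl t, _, hx, hr => by
      obtain ⟨y, hy, rfl⟩ := hx
      exact ⟨y, F.mem_car_of_forall₂ h r t y hy hr, rfl⟩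
  | .sum _ G, _, _, h, r, .inr t, _, hx, hr => by
      obtain ⟨y, hy, rfl⟩ := hx
      exact ⟨y, G.mem_car_of_forall₂ h r t y hy hr, rfl⟩

/-- If every member of `h s` is related by `D` to a member of `r s`, then a sequence of members of
the `h s` is the sequence of first components of pairs related by `D` whose second components are
members of the `r s`. -/
theorem exists_forall₂_pairs_of_forall₂ {X Y : Type} {h r : X → Set Y} {D : Y → Y → Prop}
    {ss : List X} {ps : List Y} (hD : ∀ s ∈ ss, ∀ p ∈ h s, ∃ p' ∈ r s, D p p')
    (hs : List.Forall₂ (fun s p => p ∈ h s) ss ps) :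
    ∃ e : List (Y × Y), e.map Prod.fst = ps ∧
      List.Forall₂ (fun s pp => pp.1 ∈ h s ∧ pp.2 ∈ r s) ss e ∧ ∀ pp ∈ e, D pp.1 pp.2 := by
  induction hs with
  | nil => exact ⟨[], rfl, .nil, by simp⟩
  | @cons s p ss ps hp _ ih =>
    obtain ⟨e, he, h₁, h₂⟩ := ih fun s hs => hD s (List.mem_cons_of_mem _ hs)
    obtain ⟨p', hp', hd⟩ := hD s List.mem_cons_self p hp
    refine ⟨(p, p') :: e, by simp [he], .cons ⟨hp, hp'⟩ h₁, ?_⟩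
    intro pp hpp
    rcases List.mem_cons.1 hpp with rfl | hpp
    · exact hd
    · exact h₂ pp hpp

theorem PF.car_mono : (F : PF) → {X Y : Type} → (r h : X → Set Y) → (t : F.obj X) →
    (∀ s ∈ F.elems t, r s ⊆ h s) → F.car (F.map r t) ⊆ F.car (F.map h t)
  | .I, _, _, _, _, t, hs => hs t (List.mem_singleton.2 rfl)
  | .const _, _, _, _, _, _, _ => subset_rfl
  | .prod F G, _, _, r, h, t, hs => by
      simp only [PF.elems, List.mem_append] at hs
      exact Set.prod_mono (F.car_mono r h t.1 fun s h => hs s (.inl h))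
        (G.car_mono r h t.2 fun s h => hs s (.inr h))
  | .sum F _, _, _, r, h, .inl t, hs => Set.image_mono (F.car_mono r h t hs)
  | .sum _ G, _, _, r, h, .inr t, hs => Set.image_mono (G.car_mono r h t hs)

theorem PF.car_finite : (F : PF) → {X Y : Type} → (r : X → Set Y) → (t : F.obj X) →
    (∀ s ∈ F.elems t, (r s).Finite) → (F.car (F.map r t)).Finite
  | .I, _, _, _, t, hs => hs t (List.mem_singleton.2 rfl)
  | .const _, _, _, _, _, _ => Set.finite_singleton _
  | .prod F G, _, _, r, t, hs => by
      simp only [PF.elems, List.mem_append] at hs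
      exact (F.car_finite r t.1 fun s h => hs s (.inl h)).prod
        (G.car_finite r t.2 fun s h => hs s (.inr h))
  | .sum F _, _, _, r, .inl t, hs => (F.car_finite r t hs).image _
  | .sum _ G, _, _, r, .inr t, hs => (G.car_finite r t hs).image _

theorem PF.car_map_image : (F : PF) → {X Y Z : Type} → (f : Y → Z) → (r : X → Set Y) →
    (t : F.obj X) → F.car (F.map (fun s => f '' r s) t) = F.map f '' F.car (F.map r t)
  | .I, _, _, _, _, _, _ => rfl
  | .const _, _, _, _, _, _, _ => (Set.image_singleton).symm
  | .prod F G, _, _, _, f, r, t => by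
      simp only [PF.map, PF.car, F.car_map_image f r, G.car_map_image f r]
      exact Set.prod_image_image_eq
  | .sum F _, _, _, _, f, r, .inl t => by
      simp only [PF.map, PF.car, F.car_map_image f r]
      exact Set.image_comm fun _ => rfl
  | .sum _ G, _, _, _, f, r, .inr t => by
      simp only [PF.map, PF.car, G.car_map_image f r]
      exact Set.image_comm fun _ => rfl

/-- Correct synthesized components assemble to the image of the value. -/
theorem PF.build_eq_map : (F : PF) → {E B B' : Type} → (f : B → B') → (y : F.Synth E B') →
    (e : E) → (v : F.obj B) → F.SynthCorrect f y e v → F.build y e = F.map f v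
  | .I, _, _, _, _, _, _, _, h => h.symm
  | .const _, _, _, _, _, _, _, _, h => h.symm
  | .prod F G, _, _, _, f, y, e, v, h => by
      simp only [PF.build, PF.map]
      rw [F.build_eq_map f y.1 e v.1 h.1, G.build_eq_map f y.2 e v.2 h.2]
  | .sum F _, _, _, _, f, y, e, .inl v, h => by
      simp only [PF.build, PF.map, h.1]
      rw [F.build_eq_map f y.2.1 e v h.2]
  | .sum _ G, _, _, _, f, y, e, .inr v, h => by
      simp only [PF.build, PF.map, h.1]
      rw [G.build_eq_map f y.2.2 e v h.2]

/-! ### Correctness of rewriting -/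

/-- The synthesized queries give the right values on the invocations in `T`, when the input `s` is
replaced by `s'`. -/
def QueriesCorrect {σ σ' : Ty} (q : Queries σ σ') (s : Val σ) (s' : Val σ')
    (T : Set (Event σ)) : Prop :=
  ∀ v ∈ T, v.expr.eval s v.env = q v.expr s' v.env

theorem Expr.rewritable_iff_isSome {σ σ' : Ty} (q : Queries σ σ') {Γ : List Ty} {τ : Ty}
    (e : Expr σ Γ τ) : e.Rewritable ↔ (e.rewrite q).isSome := by
  induction e with
  | input => simp [Expr.Rewritable, Expr.rewrite]
  | var => simp [Expr.Rewritable, Expr.rewrite]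
  | const => simp [Expr.Rewritable, Expr.rewrite]
  | op args sem operands ih =>
    simp only [Expr.Rewritable, Expr.rewrite, ih]
    split_ifs <;> simp_all
  | call f =>
    simp only [Expr.Rewritable, Expr.rewrite]
    split_ifs <;> simp_all

/-- Operands that agree on the calls actually made, whose records lie in `T`, give the same
result. -/
theorem OpSem.run_congr {n : ℕ} {args : Fin n → List Ty × Ty} {τ : Ty} {E : Type 1}
    (f f' : (j : Fin n) → Env (args j).1 → Val (args j).2)
    (g : (j : Fin n) → Env (args j).1 → Set E) (T : Set E)
    (h : ∀ j xs, g j xs ⊆ T → f j xs = f' j xs) (sem : OpSem args τ)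
    (hT : sem.trace f g ⊆ T) : sem.run f = sem.run f' := by
  induction sem with
  | ret v => rfl
  | call j xs k ih =>
    simp only [OpSem.trace, Set.union_subset_iff] at hT
    simp only [OpSem.run]
    rw [← h j xs hT.1]
    exact ih _ hT.2

theorem Expr.eval_rewrite {σ σ' : Ty} (q : Queries σ σ') (s : Val σ) (s' : Val σ') {Γ : List Ty}
    {τ : Ty} (e : Expr σ Γ τ) : ∀ (env : Env Γ) (e' : Expr σ' Γ τ), e.rewrite q = some e' →
      QueriesCorrect q s s' (e.queryTrace s env) → e'.eval s' env = e.eval s env := by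
  induction e with
  | input => intro env e' h; simp [Expr.rewrite] at h
  | var x =>
    intro env e' h _
    simp only [Expr.rewrite, Option.some.injEq] at h
    subst h; rfl
  | const v =>
    intro env e' h _
    simp only [Expr.rewrite, Option.some.injEq] at h
    subst h; rfl
  | op args sem operands ih =>
    intro env e' h hq
    simp only [Expr.queryTrace, Expr.rewritable_iff_isSome q] at hq
    simp only [Expr.rewrite] at h
    split_ifs at h with h₁ h₂
    · rw [if_pos h₁] at hq
      obtain rfl := Option.some.inj h
      refine (OpSem.run_congr _ _ _
        {v : Event _ | v.expr.eval s v.env = q v.expr s' v.env} ?_ sem hq).symm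
      intro j xs hg
      exact (ih j _ _ (Option.some_get _).symm hg).symm
    · rw [if_neg h₁, if_pos h₂] at hq
      obtain rfl := Option.some.inj h
      exact (hq _ rfl).symm
  | call f =>
    intro env e' h hq
    simp only [Expr.queryTrace] at hq
    simp only [Expr.rewrite] at h
    split_ifs at h with h₁
    rw [if_pos h₁] at hq
    obtain rfl := Option.some.inj h
    exact (hq _ rfl).symm

/-- If the synthesized queries and constructors are correct on all their invocations, then the
rewritten statement collects the images of the values collected by the original one. -/
theorem Stmt.exec_rewrite {σ σ' ρ ρ' : Ty} (q : Queries σ σ')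
    (c : {Γ : List Ty} → Expr σ Γ ρ → Val σ' → Env Γ → Val ρ') (g : Val ρ → Val ρ')
    (s : Val σ) (s' : Val σ') {Γ : List Ty} (a : Stmt σ ρ Γ) :
    ∀ (env : Env Γ) (a' : Stmt σ' ρ' Γ), a.rewrite q c = some a' →
      QueriesCorrect q s s' (a.queryTrace s env) →
      (∀ {Δ : List Ty} (e : Expr σ Δ ρ) (env' : Env Δ), ⟨e, env'⟩ ∈ a.collectTrace s env →
        g (e.eval s env') = c e s' env') →
      a'.exec s' env = (a.exec s env).map g := by
  induction a with
  | skip =>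
    intro env a' h _ _
    obtain rfl := Option.some.inj h
    rfl
  | seq a b iha ihb =>
    intro env a' h hq hc
    simp only [Stmt.rewrite, Option.bind_eq_bind, Option.bind_eq_some_iff] at h
    obtain ⟨a₁, ha, b₁, hb, h⟩ := h
    obtain rfl := Option.some.inj h
    simp only [Stmt.exec, List.map_append]
    rw [iha env a₁ ha (fun v hv => hq v (.inl hv)) (fun e env' h => hc e env' (.inl h)),
      ihb env b₁ hb (fun v hv => hq v (.inr hv)) (fun e env' h => hc e env' (.inr h))]
  | ite e a b iha ihb =>
    intro env a' h hq hc
    simp only [Stmt.rewrite, Option.bind_eq_bind, Option.bind_eq_some_iff] at h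
    obtain ⟨e₁, he, a₁, ha, b₁, hb, h⟩ := h
    obtain rfl := Option.some.inj h
    have hev := e.eval_rewrite q s s' env e₁ he fun v hv => hq v (.inl hv)
    have hq' := fun v hv => hq v (.inr hv)
    simp only [Stmt.exec, Stmt.collectTrace] at hc ⊢
    rw [hev]
    generalize (e.eval s env) = cond at hq' hc ⊢
    cases cond
    · exact ihb env b₁ hb hq' hc
    · exact iha env a₁ ha hq' hc
  | collect e =>
    intro env a' h _ hc
    obtain rfl := Option.some.inj h
    exact congrArg (fun v => [v]) (hc e env rfl).symm
  | foreach e a iha =>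
    intro env a' h hq hc
    simp only [Stmt.rewrite, Option.bind_eq_bind, Option.bind_eq_some_iff] at h
    obtain ⟨e₁, he, a₁, ha, h⟩ := h
    obtain rfl := Option.some.inj h
    have hev := e.eval_rewrite q s s' env e₁ he fun v hv => hq v (.inl hv)
    simp only [Stmt.exec]
    rw [hev]
    exact Eq.trans (List.flatMap_congr fun x hx =>
      iha (x, env) a₁ ha (fun v hv => hq v (.inr ⟨x, hx, hv⟩))
        (fun e' env' h => hc e' env' ⟨x, hx, h⟩)) List.map_flatMap.symm

/-! ### Search trees and recursive generators -/

section Generators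

variable {F : PF} {A A' B : Type}

theorem States.self (ψ : B → Set (F.obj B)) (i : B) : i ∈ States ψ i := .refl

theorem States.child {ψ : B → Set (F.obj B)} {i s s' : B} (hs : s ∈ States ψ i)
    (h : Child ψ s' s) : s' ∈ States ψ i := .tail hs h

theorem States.terminates {ψ : B → Set (F.obj B)} {i s : B} (hi : Terminates ψ i)
    (hs : s ∈ States ψ i) : Terminates ψ s := by
  induction hs with
  | refl => exact hi
  | tail _ h ih => exact ih.inv h

/-- A property of all states in the search tree of a terminating state can be proved from the
subtrees up. -/
theorem States.induction {ψ : B → Set (F.obj B)} {i : B} (hi : Terminates ψ i) {C : B → Prop}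
    (step : ∀ s ∈ States ψ i, (∀ s', Child ψ s' s → C s') → C s) :
    ∀ s ∈ States ψ i, C s := by
  intro s hs
  have hacc := States.terminates hi hs
  induction hacc with
  | intro s hacc ih => exact step s hs fun s' h => ih s' h (States.child hs h)

theorem mem_expand {ψ : B → Set (F.obj B)} {r : B → Set A} {s : B} {x : F.obj A} :
    x ∈ expand ψ r s ↔ ∃ t ∈ ψ s, x ∈ F.car (F.map r t) := by
  simp [expand]

theorem mem_lift {φ : F.obj A → Set A} {X : Set (F.obj A)} {p : A} :
    p ∈ lift φ X ↔ ∃ x ∈ X, p ∈ φ x := by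
  simp [lift]

theorem expand_finite {ψ : B → Set (F.obj B)} {r : B → Set A} {s : B} (hψ : (ψ s).Finite)
    (hr : ∀ s', Child ψ s' s → (r s').Finite) : (expand ψ r s).Finite :=
  hψ.biUnion fun t ht => F.car_finite r t fun s' hs' => hr s' ⟨t, ht, hs'⟩

theorem expand_image (ψ : B → Set (F.obj B)) (f : A → A') (r : B → Set A) (s : B) :
    expand ψ (fun s => f '' r s) s = F.map f '' expand ψ r s := by
  simp only [expand, Set.image_iUnion, F.car_map_image]

theorem lift_image {φ : F.obj A → Set A} {φ' : F.obj A' → Set A'} {f : A → A'}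
    {X : Set (F.obj A)} (h : ∀ x ∈ X, φ' (F.map f x) = f '' φ x) :
    lift φ' (F.map f '' X) = f '' lift φ X := by
  simp only [lift, Set.biUnion_image, Set.image_iUnion]
  exact Set.iUnion₂_congr h

theorem thin_subset (R : A → A → Prop) (X : Set A) : thin R X ⊆ X := fun _ h => h.1

/-- Thinning commutes with maps under which the two preorders correspond on `X`; the map need not
be injective. -/
theorem thin_image {R : A → A → Prop} {R' : A' → A' → Prop} {f : A → A'} {X : Set A}
    (h : ∀ a ∈ X, ∀ b ∈ X, R' (f a) (f b) ↔ R a b) : thin R' (f '' X) = f '' thin R X := by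
  ext y
  constructor
  · rintro ⟨⟨a, ha, rfl⟩, hmax⟩
    exact ⟨a, ⟨ha, fun b hb hab => (h b hb a ha).1
      (hmax (f b) ⟨b, hb, rfl⟩ ((h a ha b hb).2 hab))⟩, rfl⟩
  · rintro ⟨a, ⟨ha, hmax⟩, rfl⟩
    refine ⟨⟨a, ha, rfl⟩, ?_⟩
    rintro _ ⟨b, hb, rfl⟩ hab
    exact (h b hb a ha).2 (hmax b hb ((h a ha b hb).1 hab))

end Generators

/-! ### Keyword preorders -/

theorem Keywords.Rel.refl {α : Type} (R : Keywords α) (a : α) : R.Rel a a := by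
  rintro ⟨_ | _, k⟩ _
  · exact le_refl (k a)
  · rfl

theorem Keywords.Rel.trans {α : Type} (R : Keywords α) (a b c : α) (h₁ : R.Rel a b)
    (h₂ : R.Rel b c) : R.Rel a c := by
  rintro ⟨op, k⟩ hk
  have h₁ := h₁ _ hk
  have h₂ := h₂ _ hk
  cases op
  · exact le_trans (α := ℤ) h₁ h₂
  · exact Eq.trans h₁ h₂

theorem exists_mem_thin_of_mem {α : Type} (R : Keywords α) {X : Set α} (hX : X.Finite) {a : α}
    (ha : a ∈ X) : ∃ b ∈ thin R.Rel X, R.Rel a b :=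
  (thin_isLeast R.Rel (Keywords.Rel.refl R) (Keywords.Rel.trans R) X hX).1.2.1 a ha

theorem Stmt.denote_finite {σ ρ : Ty} (a : Stmt σ ρ []) (s : Val σ) : (a.denote s).Finite :=
  List.finite_toSet _

/-! ### Thinning a relational hylomorphism -/

theorem ThinProgram.r_eq {F : PF} {B : Ty} (P : ThinProgram F B) {i s : Val B}
    (hi : Terminates P.ψ i) (hs : s ∈ States P.ψ i) :
    P.r s = thin P.R.Rel (lift P.φ (expand P.ψ P.r s)) :=
  rg_eq _ _ s (States.terminates hi hs)

theorem ThinProgram.lift_finite {F : PF} {B : Ty} (P : ThinProgram F B) {i : Val B}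
    (hi : Terminates P.ψ i) :
    ∀ s ∈ States P.ψ i, (lift P.φ (expand P.ψ P.r s)).Finite := by
  refine States.induction hi fun s hs ih => ?_
  refine (expand_finite (P.psi.denote_finite s) fun s' hs' => ?_).biUnion
    fun x _ => P.phi.denote_finite x
  rw [P.r_eq hi (States.child hs hs')]
  exact (ih s' hs').subset (thin_subset _ _)

/-- Without counterexamples, thinning in every state of the search tree keeps, for every solution of
the hylomorphism, a solution that dominates it. -/
theorem HyloProgram.thinned_dominates (P : HyloProgram) {R : Keywords (Val P.A)} {i : Val P.B}
    (hi : Terminates P.ψ i) (hCE : P.CE R i = ∅) :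
    ∀ s ∈ States P.ψ i, (P.thinned R).r s ⊆ P.h s ∧
      ∀ p ∈ P.h s, ∃ p' ∈ (P.thinned R).r s, R.Rel p p' := by
  refine States.induction hi fun s hs ih => ?_
  have hr : (P.thinned R).r s = thin R.Rel (lift P.φ (expand P.ψ (P.thinned R).r s)) :=
    (P.thinned R).r_eq hi hs
  have hh : P.h s = lift P.φ (expand P.ψ P.h s) := rg_eq _ _ s (States.terminates hi hs)
  constructor
  · intro p hp
    rw [hr] at hp
    obtain ⟨x, hx, hpx⟩ := mem_lift.1 (thin_subset _ _ hp)
    obtain ⟨t, ht, hxt⟩ := mem_expand.1 hx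
    rw [hh]
    exact mem_lift.2 ⟨x, mem_expand.2
      ⟨t, ht, P.F.car_mono _ _ t (fun s' hs' => (ih s' ⟨t, ht, hs'⟩).1) hxt⟩, hpx⟩
  · intro p hp
    have hp' := hp
    rw [hh] at hp'
    obtain ⟨x, hx, hpx⟩ := mem_lift.1 hp'
    obtain ⟨t, ht, hxt⟩ := mem_expand.1 hx
    obtain ⟨e, he, hmem, hrel⟩ := exists_forall₂_pairs_of_forall₂
      (r := fun s' => (P.thinned R).r s' ∩ P.h s') (D := R.Rel) (fun s' hs' q hq => by
        obtain ⟨hsub, hdom⟩ := ih s' ⟨t, ht, hs'⟩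
        obtain ⟨q', hq', h⟩ := hdom q hq
        exact ⟨q', ⟨hq', hsub hq'⟩, h⟩) (P.F.forall₂_elems_of_mem_car _ t x hxt)
    -- The dominating arguments yield a dominating solution, as `e` is not a counterexample.
    obtain ⟨p₂, ⟨t₂, ht₂, hss, x₂, hx₂, hps, hp₂⟩, hp₁₂⟩ :
        ∃ p₂, P.Constructs s (P.F.elems t) (e.map Prod.snd) p₂ ∧ R.Rel p p₂ := by
      by_contra hno
      have : e ∈ P.CE R i := by
        exact ⟨s, hs, P.F.elems t, fun s' hs' => ⟨t, ht, hs'⟩,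
          hmem.imp fun _ _ h => ⟨h.1, h.2.2⟩, hrel, p,
          ⟨t, ht, rfl, x, hxt, he.symm, hpx⟩, fun p₂ h₁ h₂ => hno ⟨p₂, h₁, h₂⟩⟩
      rw [hCE] at this
      exact this
    have hx₂' : x₂ ∈ P.F.car (P.F.map (P.thinned R).r t₂) := by
      refine P.F.mem_car_of_forall₂ _ _ t₂ x₂ hx₂ ?_
      rw [hss, hps]
      exact List.forall₂_map_right_iff.2 (hmem.imp fun _ _ h => h.2.1)
    obtain ⟨p', hp', h⟩ := exists_mem_thin_of_mem R ((P.thinned R).lift_finite hi s hs)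
      (mem_lift.2 ⟨x₂, mem_expand.2 ⟨t₂, ht₂, hx₂'⟩, hp₂⟩)
    refine ⟨p', ?_, Keywords.Rel.trans R _ _ _ hp₁₂ h⟩
    rw [hr]
    exact hp'

/-! ### Changing the representation of partial solutions -/

/-- The program obtained from a solution of the synthesis task and the rewritten body of `φ`. -/
def Step2Solution.program {F : PF} {B : Ty} {P : ThinProgram F B} {I : Set (Val B)}
    (S : Step2Solution P I) (phi' : Stmt (.app F S.A') S.A' []) : ThinProgram F B where
  A := S.A'
  phi := phi'
  psi := P.psi
  R := P.R.map (fun c => (c.1, S.qKey c.2))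
  o := S.qKey P.o

theorem Step2Solution.φ_program_map {F : PF} {B : Ty} {P : ThinProgram F B} {I : Set (Val B)}
    (S : Step2Solution P I) {phi' : Stmt (.app F S.A') S.A' []}
    (hphi : P.phi.rewrite S.q S.c = some phi') {i : Val B} (hI : i ∈ I)
    {x : F.obj (Val P.A)} (hx : x ∈ P.phiInputs i) :
    (S.program phi').φ (F.map S.f x) = S.f '' P.φ x := by
  have h : Stmt.exec (σ := .app F S.A') (F.map S.f x) phi' () =
      (Stmt.exec (σ := .app F P.A) x P.phi ()).map S.f :=
    P.phi.exec_rewrite S.q S.c S.f x (F.map S.f x) () phi' hphi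
      (fun v hv => S.query_correct i hI v.expr (x, v.env) ⟨hx, hv⟩)
      (fun e env hv => S.constructor_correct i hI e (x, env) ⟨hx, hv⟩)
  ext v
  change v ∈ Stmt.exec (σ := .app F S.A') (F.map S.f x) phi' () ↔ _
  rw [h]
  exact List.mem_map

/-- On the arguments of `thin` in a run, the rewritten keyword preorder compares images as the
original one compares the partial solutions. -/
theorem Step2Solution.rel_program_iff {F : PF} {B : Ty} {P : ThinProgram F B} {I : Set (Val B)}
    (S : Step2Solution P I) (phi' : Stmt (.app F S.A') S.A' []) {i s : Val B} (hI : i ∈ I)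
    (hs : s ∈ States P.ψ i) {a b : Val P.A} (ha : a ∈ lift P.φ (expand P.ψ P.r s))
    (hb : b ∈ lift P.φ (expand P.ψ P.r s)) :
    (S.program phi').R.Rel (S.f a) (S.f b) ↔ P.R.Rel a b := by
  refine List.forall_mem_map.trans (forall₂_congr fun c hc => ?_)
  change c.1.Holds (S.qKey c.2 (S.f a)) (S.qKey c.2 (S.f b)) ↔ _
  rw [← S.key_correct i hI c.2 a (.inl ⟨⟨c.1, hc⟩, s, hs, ha⟩),
    ← S.key_correct i hI c.2 b (.inl ⟨⟨c.1, hc⟩, s, hs, hb⟩)]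

/-- Correct synthesized functions turn the results of the generator into their images under the
change of representation. -/
theorem Step2Solution.r_program {F : PF} {B : Ty} {P : ThinProgram F B} {I : Set (Val B)}
    (S : Step2Solution P I) {phi' : Stmt (.app F S.A') S.A' []}
    (hphi : P.phi.rewrite S.q S.c = some phi') {i : Val B} (hI : i ∈ I) (hi : Terminates P.ψ i) :
    ∀ s ∈ States P.ψ i, (S.program phi').r s = S.f '' P.r s := by
  refine States.induction hi fun s hs ih => ?_
  have hr : (S.program phi').r s = thin (S.program phi').R.Rel
      (lift (S.program phi').φ (expand P.ψ (S.program phi').r s)) :=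
    (S.program phi').r_eq (i := i) hi hs
  have hexp : expand P.ψ (S.program phi').r s = F.map S.f '' expand P.ψ P.r s :=
    (expand_congr P.ψ _ _ s ih).trans (expand_image P.ψ S.f P.r s)
  have hlift : lift (S.program phi').φ (expand P.ψ (S.program phi').r s) =
      S.f '' lift P.φ (expand P.ψ P.r s) :=
    (congrArg (lift _) hexp).trans
      (lift_image fun x hx => S.φ_program_map hphi hI ⟨s, hs, hx⟩)
  rw [hr, hlift, P.r_eq hi hs]
  exact thin_image fun a ha b hb => S.rel_program_iff phi' hI hs ha hb

/-! ### Memoization -/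

section Memo

/-- Started in a state with the invariant `Inv`, the computation `m` succeeds with result `v` and
preserves the invariant. -/
def Yields {S X : Type} (Inv : S → Prop) (m : StateT S Option X) (v : X) : Prop :=
  ∀ st, Inv st → ∃ st', m st = some (v, st') ∧ Inv st'

theorem Yields.pure {S X : Type} (Inv : S → Prop) (v : X) :
    Yields Inv (Pure.pure v : StateT S Option X) v :=
  fun st hst => ⟨st, rfl, hst⟩

theorem stateT_bind_apply_of_eq {S X Y : Type} {m : StateT S Option X} {st st' : S} {v : X}
    (h : m st = some (v, st')) (k : X → StateT S Option Y) : (m >>= k) st = k v st' := by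
  change (m st).bind (fun p => k p.1 p.2) = _
  rw [h]
  rfl

theorem Yields.bind {S X Y : Type} {Inv : S → Prop} {m : StateT S Option X} {v : X}
    {k : X → StateT S Option Y} {w : Y} (hm : Yields Inv m v) (hk : Yields Inv (k v) w) :
    Yields Inv (m >>= k) w := by
  intro st hst
  obtain ⟨st₁, h₁, hst₁⟩ := hm st hst
  rw [stateT_bind_apply_of_eq h₁]
  exact hk st₁ hst₁

theorem Yields.pf_mapM {S : Type} {Inv : S → Prop} : (F : PF) → {X Y : Type} →
    (m : X → StateT S Option Y) → (r : X → Y) → (t : F.obj X) →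
    (∀ s ∈ F.elems t, Yields Inv (m s) (r s)) → Yields Inv (F.mapM m t) (F.map r t)
  | .I, _, _, _, _, t, h => h t (List.mem_singleton.2 rfl)
  | .const _, _, _, _, _, _, _ => Yields.pure Inv _
  | .prod F G, _, _, m, r, t, h => by
      simp only [PF.elems, List.mem_append] at h
      exact (Yields.pf_mapM F m r t.1 fun s hs => h s (.inl hs)).bind
        ((Yields.pf_mapM G m r t.2 fun s hs => h s (.inr hs)).bind (Yields.pure Inv _))
  | .sum F _, _, _, m, r, .inl t, h => (Yields.pf_mapM F m r t h).bind (Yields.pure Inv _)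
  | .sum _ G, _, _, m, r, .inr t, h => (Yields.pf_mapM G m r t h).bind (Yields.pure Inv _)

theorem Yields.list_mapM {S X Y : Type} {Inv : S → Prop} {m : X → StateT S Option Y} {r : X → Y}
    {l : List X} (h : ∀ x ∈ l, Yields Inv (m x) (r x)) : Yields Inv (l.mapM m) (l.map r) := by
  induction l with
  | nil => exact Yields.pure Inv _
  | cons x l ih =>
    rw [List.mapM_cons]
    exact (h x List.mem_cons_self).bind
      ((ih fun y hy => h y (List.mem_cons_of_mem _ hy)).bind (Yields.pure Inv _))

variable {F : PF} {A B K : Type}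

theorem memoRun_succ_hit (φ : Set (F.obj A) → Set A) (ψ : B → List (F.obj B)) (key : B → K)
    (n : ℕ) (s : B) (st : MemoState A B K) {v : Set A} (h : st.buffer (key s) = some v) :
    memoRun φ ψ key (n + 1) s st =
      some (v, ⟨st.buffer, insert s st.called, st.expanded⟩) := by
  rw [memoRun, stateT_bind_apply_of_eq (v := ())
      (st' := ⟨st.buffer, insert s st.called, st.expanded⟩) rfl,
    stateT_bind_apply_of_eq (v := ⟨st.buffer, insert s st.called, st.expanded⟩)
      (st' := ⟨st.buffer, insert s st.called, st.expanded⟩) rfl]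
  simp only [h]
  rfl

open Classical in
theorem memoRun_succ_miss (φ : Set (F.obj A) → Set A) (ψ : B → List (F.obj B)) (key : B → K)
    (n : ℕ) (s : B) (st : MemoState A B K) (h : st.buffer (key s) = none) :
    memoRun φ ψ key (n + 1) s st =
      ((ψ s).mapM (fun t => F.mapM (memoRun φ ψ key n) t)
        (⟨st.buffer, insert s st.called, insert s st.expanded⟩ : MemoState A B K)).map
        (fun p => (φ {y | ∃ x ∈ p.1, y ∈ F.car x},
          ⟨Function.update p.2.buffer (key s) (some (φ {y | ∃ x ∈ p.1, y ∈ F.car x})),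
            p.2.called, p.2.expanded⟩)) := by
  rw [memoRun, stateT_bind_apply_of_eq (v := ())
      (st' := ⟨st.buffer, insert s st.called, st.expanded⟩) rfl,
    stateT_bind_apply_of_eq (v := ⟨st.buffer, insert s st.called, st.expanded⟩)
      (st' := ⟨st.buffer, insert s st.called, st.expanded⟩) rfl]
  simp only [h]
  rw [Option.map_eq_bind]
  rfl

/-- Every result in the buffer is the one of each state of `X` with this key. -/
def BufferCorrect (key : B → K) (r : B → Set A) (X : Set B) (st : MemoState A B K) : Prop :=
  ∀ s ∈ X, ∀ v, st.buffer (key s) = some v → v = r s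

open Classical in
/-- If states of the search tree with the same key have the same result, then the memoized
generator returns the result of the recursive generator, from a correct buffer and for any large
enough bound on the recursion depth. -/
theorem memoRun_yields (φ : Set (F.obj A) → Set A) (ψ : B → List (F.obj B)) (key : B → K) {i : B}
    (hi : Terminates (fun s => {t | t ∈ ψ s}) i)
    (hkey : ∀ s₁ ∈ States (fun s => {t | t ∈ ψ s}) i, ∀ s₂ ∈ States (fun s => {t | t ∈ ψ s}) i,
      rg φ (fun s => {t | t ∈ ψ s}) s₁ ≠ rg φ (fun s => {t | t ∈ ψ s}) s₂ → key s₁ ≠ key s₂) :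
    ∀ s ∈ States (fun s => {t | t ∈ ψ s}) i, ∀ᶠ n in Filter.atTop,
      Yields (BufferCorrect key (rg φ fun s => {t | t ∈ ψ s}) (States (fun s => {t | t ∈ ψ s}) i))
        (memoRun φ ψ key n s) (rg φ (fun s => {t | t ∈ ψ s}) s) := by
  set ψ' : B → Set (F.obj B) := fun s => {t | t ∈ ψ s} with hψ'
  refine States.induction hi fun s hs ih => ?_
  have hall : ∀ᶠ n in Filter.atTop, ∀ t ∈ ψ' s, ∀ s' ∈ {s' | s' ∈ F.elems t},
      Yields (BufferCorrect key (rg φ ψ') (States ψ' i)) (memoRun φ ψ key n s') (rg φ ψ' s') :=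
    (Filter.eventually_all_finite (List.finite_toSet _)).2 fun t ht =>
      (Filter.eventually_all_finite (List.finite_toSet _)).2 fun s' hs' => ih s' ⟨t, ht, hs'⟩
  obtain ⟨N, hN⟩ := Filter.eventually_atTop.1 hall
  refine (Filter.eventually_ge_atTop (N + 1)).mono fun n hn => ?_
  obtain ⟨n, rfl⟩ := Nat.exists_eq_add_of_le' (Nat.le_of_add_left_le hn)
  intro st hst
  rcases hb : st.buffer (key s) with _ | v
  · have hrun := Yields.list_mapM (l := ψ s) fun t ht =>
      Yields.pf_mapM F (memoRun φ ψ key n) (rg φ ψ') t (hN n (Nat.le_of_succ_le_succ hn) t ht)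
    obtain ⟨st₁, h₁, hst₁⟩ := hrun ⟨st.buffer, insert s st.called, insert s st.expanded⟩ hst
    have hval : φ {y | ∃ x ∈ (ψ s).map (F.map (rg φ ψ')), y ∈ F.car x} = rg φ ψ' s := by
      rw [rg_eq φ ψ' s (States.terminates hi hs)]
      congr 1
      ext y
      simp [mem_expand, hψ']
    rw [memoRun_succ_miss φ ψ key n s st hb, h₁, Option.map_some, hval]
    refine ⟨_, rfl, fun s₂ hs₂ v hv => ?_⟩
    change Function.update st₁.buffer (key s) _ (key s₂) = _ at hv
    by_cases hk : key s₂ = key s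
    · rw [hk, Function.update_self] at hv
      obtain rfl := Option.some.inj hv
      by_contra hne
      exact hkey s₂ hs₂ s hs (Ne.symm hne) hk
    · rw [Function.update_of_ne hk] at hv
      exact hst₁ s₂ hs₂ v hv
  · obtain rfl := hst s hs v hb
    exact ⟨_, memoRun_succ_hit φ ψ key n s st hb, hst⟩

/-! ### Changing the representation of states -/

/-- Successful runs of `m` only ever add called and expanded states, and every one that ends with at
most the states `C` called and the states `E` expanded is matched by a run of `m'` with the same
result, from and to states with the same buffers. Because of the monotonicity, the bounds at the end
of a run hold throughout it, which makes the relation compatible with sequencing. -/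
def SimulatedBy {B' X : Type} (C E : Set B) (m : StateT (MemoState A B K) Option X)
    (m' : StateT (MemoState A B' K) Option X) : Prop :=
  ∀ st v st₁, m st = some (v, st₁) → st.called ⊆ st₁.called ∧ st.expanded ⊆ st₁.expanded ∧
    (st₁.called ⊆ C → st₁.expanded ⊆ E → ∀ st' : MemoState A B' K, st'.buffer = st.buffer →
      ∃ st₁', m' st' = some (v, st₁') ∧ st₁'.buffer = st₁.buffer)

variable {B' : Type} {C E : Set B}

theorem SimulatedBy.pure {X : Type} (v : X) :
    SimulatedBy C E (Pure.pure v : StateT (MemoState A B K) Option X)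
      (Pure.pure v : StateT (MemoState A B' K) Option X) := by
  intro st w st₁ h
  obtain ⟨rfl, rfl⟩ := Prod.mk.inj (Option.some.inj h)
  exact ⟨subset_rfl, subset_rfl, fun _ _ st' hst' => ⟨st', rfl, hst'⟩⟩

theorem SimulatedBy.bind {X Y : Type} {m : StateT (MemoState A B K) Option X}
    {m' : StateT (MemoState A B' K) Option X} {k : X → StateT (MemoState A B K) Option Y}
    {k' : X → StateT (MemoState A B' K) Option Y} (hm : SimulatedBy C E m m')
    (hk : ∀ x, SimulatedBy C E (k x) (k' x)) : SimulatedBy C E (m >>= k) (m' >>= k') := by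
  intro st w st₂ h
  obtain ⟨⟨v, st₁⟩, h₁, h₂⟩ := Option.bind_eq_some_iff.1 h
  obtain ⟨hc₁, he₁, hs₁⟩ := hm st v st₁ h₁
  obtain ⟨hc₂, he₂, hs₂⟩ := hk v st₁ w st₂ h₂
  refine ⟨hc₁.trans hc₂, he₁.trans he₂, fun hC hE st' hst' => ?_⟩
  obtain ⟨st₁', h₁', hst₁'⟩ := hs₁ (hc₂.trans hC) (he₂.trans hE) st' hst'
  rw [stateT_bind_apply_of_eq h₁']
  exact hs₂ hC hE st₁' hst₁'

theorem SimulatedBy.pf_mapM : (F : PF) → {X X' Y : Type} →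
    (m : X → StateT (MemoState A B K) Option Y) → (m' : X' → StateT (MemoState A B' K) Option Y) →
    (f : X → X') → (∀ x, SimulatedBy C E (m x) (m' (f x))) → (t : F.obj X) →
    SimulatedBy C E (F.mapM m t) (F.mapM m' (F.map f t))
  | .I, _, _, _, _, _, _, h, t => h t
  | .const _, _, _, _, _, _, _, _, _ => SimulatedBy.pure _
  | .prod F G, _, _, _, m, m', f, h, t =>
      (SimulatedBy.pf_mapM F m m' f h t.1).bind fun _ =>
        (SimulatedBy.pf_mapM G m m' f h t.2).bind fun _ => SimulatedBy.pure _
  | .sum F _, _, _, _, m, m', f, h, .inl t =>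
      (SimulatedBy.pf_mapM F m m' f h t).bind fun _ => SimulatedBy.pure _
  | .sum _ G, _, _, _, m, m', f, h, .inr t =>
      (SimulatedBy.pf_mapM G m m' f h t).bind fun _ => SimulatedBy.pure _

theorem SimulatedBy.list_mapM {X X' Y : Type} {m : X → StateT (MemoState A B K) Option Y}
    {m' : X' → StateT (MemoState A B' K) Option Y} {f : X → X'}
    (h : ∀ x, SimulatedBy C E (m x) (m' (f x))) (l : List X) :
    SimulatedBy C E (l.mapM m) ((l.map f).mapM m') := by
  induction l with
  | nil => exact SimulatedBy.pure _
  | cons x l ih =>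
    rw [List.map_cons, List.mapM_cons, List.mapM_cons]
    exact (h x).bind fun _ => ih.bind fun _ => SimulatedBy.pure _

/-- A change `f` of the representation of states is invisible in the buffer, if the keys agree on
the called states and the transitions agree on the expanded ones. -/
theorem memoRun_simulatedBy (φ : Set (F.obj A) → Set A) (ψ : B → List (F.obj B)) (key : B → K)
    (ψ' : B' → List (F.obj B')) (key' : B' → K) (f : B → B') (hkey : ∀ s ∈ C, key s = key' (f s))
    (hψ : ∀ s ∈ E, ψ' (f s) = (ψ s).map (F.map f)) (n : ℕ) :
    ∀ s, SimulatedBy C E (memoRun φ ψ key n s) (memoRun φ ψ' key' n (f s)) := by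
  induction n with
  | zero =>
    intro s st v st₁ h
    simp [memoRun] at h
  | succ n ih =>
    intro s st v st₁ h
    rcases hb : st.buffer (key s) with _ | w
    · rw [memoRun_succ_miss φ ψ key n s st hb] at h
      obtain ⟨⟨xs, st₂⟩, hrun, h⟩ := Option.map_eq_some_iff.1 h
      obtain ⟨rfl, rfl⟩ := Prod.mk.inj h
      obtain ⟨hc, he, hsim⟩ := SimulatedBy.list_mapM
        (SimulatedBy.pf_mapM F _ _ f ih) (ψ s) _ xs st₂ hrun
      refine ⟨(Set.subset_insert _ _).trans hc, (Set.subset_insert _ _).trans he,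
        fun hC hE st' hst' => ?_⟩
      have hks := hkey s (hC (hc (Set.mem_insert _ _)))
      have hψs := hψ s (hE (he (Set.mem_insert _ _)))
      obtain ⟨st₂', hrun', hst₂'⟩ := hsim hC hE
        ⟨st'.buffer, insert (f s) st'.called, insert (f s) st'.expanded⟩ hst'
      rw [memoRun_succ_miss φ ψ' key' n (f s) st' (by rw [← hks, hst', hb]), hψs, hrun']
      exact ⟨_, rfl, by simp only [hst₂', hks]⟩
    · rw [memoRun_succ_hit φ ψ key n s st hb] at h
      obtain ⟨rfl, rfl⟩ := Prod.mk.inj (Option.some.inj h)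
      refine ⟨Set.subset_insert _ _, subset_rfl, fun hC _ st' hst' => ?_⟩
      have hks := hkey s (hC (Set.mem_insert _ _))
      exact ⟨_, memoRun_succ_hit φ ψ' key' n (f s) st' (by rw [← hks, hst', hb]), hst'⟩

end Memo

/-! ### Preservation of the optimal objective value -/

theorem HyloProgram.isGreatest_thinned_iff (P : HyloProgram) {R : Keywords (Val P.A)}
    {i : Val P.B} (hi : Terminates P.ψ i) (hR : (CmpOp.le, P.o) ∈ R) (hCE : P.CE R i = ∅) (m : ℤ) :
    IsGreatest (P.o '' P.h i) m ↔ IsGreatest (P.o '' (P.thinned R).r i) m := by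
  obtain ⟨hsub, hdom⟩ := P.thinned_dominates hi hCE i (States.self _ _)
  have hle : ∀ p ∈ P.h i, ∃ p' ∈ (P.thinned R).r i, P.o p ≤ P.o p' := fun p hp => by
    obtain ⟨p', hp', h⟩ := hdom p hp
    exact ⟨p', hp', h _ hR⟩
  constructor
  · rintro ⟨⟨p, hp, rfl⟩, hub⟩
    obtain ⟨p', hp', h⟩ := hle p hp
    exact ⟨⟨p', hp', le_antisymm (hub ⟨p', hsub hp', rfl⟩) h⟩,
      fun _ ⟨q, hq, hqm⟩ => hqm ▸ hub ⟨q, hsub hq, rfl⟩⟩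
  · rintro ⟨⟨p, hp, rfl⟩, hub⟩
    refine ⟨⟨p, hsub hp, rfl⟩, ?_⟩
    rintro _ ⟨q, hq, rfl⟩
    obtain ⟨q', hq', h⟩ := hle q hq
    exact h.trans (hub ⟨q', hq', rfl⟩)

theorem Step2.ψ_eq {F : PF} {B : Ty} {I : Set (Val B)} {P P' : ThinProgram F B}
    (h : Step2 I P P') : P'.ψ = P.ψ := by
  cases h <;> rfl

theorem Step2.image_objective_eq {F : PF} {B : Ty} {I : Set (Val B)} {P P' : ThinProgram F B}
    (h : Step2 I P P') {i : Val B} (hI : i ∈ I) (hi : Terminates P.ψ i) :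
    P'.o '' P'.r i = P.o '' P.r i := by
  cases h with
  | skip => rfl
  | incrementalize S phi' hphi =>
    change S.qKey P.o '' (S.program phi').r i = _
    rw [S.r_program hphi hI hi i (States.self _ _)]
    refine (Set.image_image _ _ _).trans (Set.image_congr fun p hp => ?_)
    exact (S.key_correct i hI P.o p (.inr ⟨rfl, hp⟩)).symm

theorem ThinProgram.memoized_returns {F : PF} {B : Ty} (P : ThinProgram F B) {I : Set (Val B)}
    {K : Type} {fm : Val B → K} (h : Step3 P I fm) {i : Val B} (hI : i ∈ I)
    (hi : Terminates P.ψ i) : (P.memoized fm).toProgram.Returns i (P.r i) := by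
  obtain ⟨n, hn⟩ := (memoRun_yields P.thinLift P.ψList fm hi (h i hI) i (States.self _ _)).exists
  obtain ⟨st, hst, _⟩ := hn MemoState.init fun _ _ _ hv => nomatch hv
  exact ⟨st, n, hst⟩

theorem Step4Solution.ψList_eq {Inst : Type} {P : MemoProgram Inst} {I : Set Inst}
    (S : Step4Solution P I) {psi' : Stmt S.B' (.app P.F S.B') []}
    (hpsi : P.base.psi.rewrite S.q S.collect = some psi') {i : Inst} (hI : i ∈ I) {s : Val P.B}
    (hs : s ∈ P.psiInputs i) :
    psi'.exec (S.f s) () = (P.base.psi.exec s ()).map (P.F.map S.f) :=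
  P.base.psi.exec_rewrite S.q S.collect (P.F.map S.f) s (S.f s) () psi' hpsi
    (fun v hv => S.query_correct i hI v.expr (s, v.env) ⟨hs, hv⟩)
    (fun e env hv => (P.F.build_eq_map S.f (S.c e) (S.f s, env) (e.eval s env)
      (S.component_correct i hI e (s, env) ⟨hs, hv⟩)).symm)

theorem Step4.exists_returns {Inst : Type} {I : Set Inst} {P P' : MemoProgram Inst}
    (h : Step4 I P P') {i : Inst} (hI : i ∈ I) {v : Set (Val P.base.A)}
    (hv : P.toProgram.Returns i v) :
    ∃ w, P'.toProgram.Returns i w ∧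
      P'.toProgram.objective '' w = P.toProgram.objective '' v := by
  cases h with
  | skip => exact ⟨v, hv, rfl⟩
  | incrementalize S psi' hpsi =>
    obtain ⟨st, n, hrun⟩ := hv
    -- The bounds are the states called and expanded in the run to be simulated itself.
    obtain ⟨_, _, hsim⟩ := memoRun_simulatedBy (C := st.called) (E := st.expanded)
      P.base.thinLift P.base.ψList P.key (fun s => psi'.exec s ()) S.qKey S.f
      (fun s hs => S.key_correct i hI s ⟨v, st, ⟨n, hrun⟩, hs⟩)
      (fun s hs => S.ψList_eq hpsi hI ⟨v, st, ⟨n, hrun⟩, hs⟩) n (P.init i) _ v st hrun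
    obtain ⟨st', hrun', _⟩ := hsim subset_rfl subset_rfl MemoState.init rfl
    exact ⟨v, ⟨st', n, hrun'⟩, rfl⟩

end MetHyl

theorem mainTheorem7 (P : MetHyl.HyloProgram) (I : Set (MetHyl.Val P.B))
    (hterm : ∀ i ∈ I, MetHyl.Terminates P.ψ i)
    (p : MetHyl.MemoProgram (MetHyl.Val P.B)) (hp : MetHyl.Synthesizes P I p) :
    ∀ i ∈ I, MetHyl.Program.Equiv i P.toProgram p.toProgram := by
  intro i hI
  obtain ⟨R, ⟨hR, hCE⟩, P₂, h₂, K, fm, h₃, _, h₄⟩ := hp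
  have hi := hterm i hI
  have hi₂ : MetHyl.Terminates P₂.ψ i := by
    rw [h₂.ψ_eq]
    exact hi
  obtain ⟨w, hw, hobj⟩ := h₄.exists_returns hI (P₂.memoized_returns h₃ hI hi₂)
  refine ⟨P.h i, w, ⟨hi, rfl⟩, hw, fun m => ?_⟩
  have hobj' : p.toProgram.objective '' w = (P.thinned R).o '' (P.thinned R).r i :=
    hobj.trans (h₂.image_objective_eq hI hi)
  rw [hobj']
  exact P.isGreatest_thinned_iff hi hR (hCE i hI) m
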